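/- **$\lambda$-rings.** A $\lambda$-ring is a unital commutative ring $R$ with functions $\lambda^i\colon R\to R$ $(i\ge 0)$ such that for all $i,j\ge 0$ and $r,s\in R$: $\lambda^0(r)=1$; $\lambda^1(r)=r$; $\lambda^i(1)=0$ for $i>1$; $\lambda^i(r+s)=\sum_{k=0}^i\lambda^k(r)\lambda^{i-k}(s)$; $\lambda^i(rs)=P_i(\lambda^1(r),\dots,\lambda^i(r);\lambda^1(s),\dots,\lambda^i(s))$; $\lambda^i(\lambda^j(r))=P_{i,j}(\lambda^1(r),\dots,\lambda^{ij}(r))$. Here $P_i$ and $P_{i,j}$ are the unique polynomials with integer coefficients such that, with $s_k$ and $\sigma_k$ the elementary symmetric functions of the variables $\xi$ and $\eta$ respectively, $P_i(s_1,\dots,s_i;\sigma_1,\dots,\sigma_i)$ is the coefficient of $t^i$ in $\prod_{m,n=1}^i(1+\xi_m\eta_n t)$, and $P_{i,j}(s_1,\dots,s_{ij})$ is the coefficient of $t^i$ in $\prod_{1\le l_1<\dots<l_j\le ij}(1+\xi_{l_1}\cdots\xi_{l_j}t)$. The Adams operations $\psi^n\colon R\to R$ $(n\ge 1)$ are defined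 inductively by $\psi^n(r)-\lambda^1(r)\psi^{n-1}(r)+\dots+(-1)^{n-1}\lambda^{n-1}(r)\psi^1(r)+(-1)^n n\lambda^n(r)=0$; they are additive. **Cohomology.** Let $\mathrm{End}(R)$ be the algebra of $\mathbf Z$-linear endomorphisms of $R$ and $T$ the set of positive integers. Let $\mathcal F^0(R)$ be the additive group of all $g\in\mathrm{End}(R)$ with $g(r)^p\equiv g(r^p)\pmod{pR}$ for every prime $p$ and $r\in R$; let $\mathcal F^1(R)$ be the additive group of functions $f\colon T\to\mathrm{End}(R)$ with $f(p)(R)\subseteq pR$ for every prime $p$; and let $\mathcal F^2(R)$ be the additive group of all functions $T^2\to\mathrm{End}(R)$. Put $(d^0g)(n)=\psi^ng-g\psi^n$ and $(d^1f)(m,n)=\psi^mf(n)-f(mn)+f(m)\psi^n$. Then $H^1_\lambda(R)=\ker d^1/\operatorname{im}d^0$. The elements of $\ker d^1$ are called $\lambda$-derivations: they are the $f\in\mathcal F^1(R)$ with $f(mn)=\psi^mf(n)+f(m)\psi^n$ for all $m,n\ge 1$. Let $\overline{\mathrm{Der}}_\lambda(R)$ be the group of families $(f(p))_p$ in $\mathrm{End}(R)$,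 indexed by the primes, with $f(p)(R)\subseteq pR$ and $\psi^pf(q)+f(p)\psi^q=\psi^qf(p)+f(q)\psi^p$ for all primes $p,q$. Let $\overline{\mathrm{Inn}}_\lambda(R)$ be its subgroup of families $(\psi^pg-g\psi^p)_p$ with $g\in\mathcal F^0(R)$, and let $\bar H^1_\lambda(R)=\overline{\mathrm{Der}}_\lambda(R)/\overline{\mathrm{Inn}}_\lambda(R)$. **Theorem.** For every $\lambda$-ring $R$, the restriction of $\lambda$-derivations to the primes induces a well-defined group isomorphism $$\pi\colon H^1_\lambda(R)\longrightarrow\bar H^1_\lambda(R),\qquad [f]\longmapsto[(f(p))_p].$$ -/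

import Mathlib

namespace LambdaCohomology

open MvPolynomial

/-! ### The universal polynomials -/

/-- `P` is the polynomial `P_i` in the `2i` variables `s_1, …, s_i; σ_1, …, σ_i` (the variable
`Sum.inl k` is `s_{k+1}`, the variable `Sum.inr k` is `σ_{k+1}`): when the elementary symmetric
functions of `ξ_1, …, ξ_i` and of `η_1, …, η_i` are substituted, the result is the coefficient of
`t^i` in `∏_{m,n} (1 + ξ_m η_n t)`. -/
def IsMulPoly (i : ℕ) (P : MvPolynomial (Fin i ⊕ Fin i) ℤ) : Prop :=
  aeval (Sum.elim
      (fun k : Fin i => rename (Sum.inl : Fin i → Fin i ⊕ Fin i) (esymm (Fin i) ℤ (k + 1)))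
      (fun k : Fin i => rename (Sum.inr : Fin i → Fin i ⊕ Fin i) (esymm (Fin i) ℤ (k + 1)))) P =
    (∏ m : Fin i, ∏ n : Fin i,
      (1 + Polynomial.C (X (Sum.inl m) * X (Sum.inr n) : MvPolynomial (Fin i ⊕ Fin i) ℤ) *
        Polynomial.X)).coeff i

/-- `P` is the polynomial `P_{i,j}` in the `ij` variables `s_1, …, s_{ij}` (the variable `k` is
`s_{k+1}`): when the elementary symmetric functions of `ξ_1, …, ξ_{ij}` are substituted, the result
is the coefficient of `t^i` in `∏_{l_1 < ⋯ < l_j} (1 + ξ_{l_1} ⋯ ξ_{l_j} t)`. -/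
def IsCompPoly (i j : ℕ) (P : MvPolynomial (Fin (i * j)) ℤ) : Prop :=
  aeval (fun k : Fin (i * j) => esymm (Fin (i * j)) ℤ (k + 1)) P =
    (∏ L ∈ Finset.powersetCard j (Finset.univ : Finset (Fin (i * j))),
      (1 + Polynomial.C (∏ l ∈ L, X l : MvPolynomial (Fin (i * j)) ℤ) * Polynomial.X)).coeff i

/-- A symmetric polynomial in `n` variables is a polynomial in the elementary symmetric ones. -/
theorem exists_aeval_esymm {A : Type*} [CommRing A] {n : ℕ} {Q : MvPolynomial (Fin n) A}
    (hQ : Q.IsSymmetric) :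
    ∃ P : MvPolynomial (Fin n) A, aeval (fun k : Fin n => esymm (Fin n) A (k + 1)) P = Q := by
  obtain ⟨P, hP⟩ := esymmAlgHom_surjective (σ := Fin n) (R := A) (n := n) (by simp) ⟨Q, hQ⟩
  exact ⟨P, by rw [← esymmAlgHom_apply, hP]⟩

theorem existsUnique_compPoly (i j : ℕ) : ∃! P, IsCompPoly i j P := by
  obtain ⟨P, hP⟩ := exists_aeval_esymm (A := ℤ) (n := i * j)
    (Q := (∏ L ∈ Finset.powersetCard j (Finset.univ : Finset (Fin (i * j))),
      (1 + Polynomial.C (∏ l ∈ L, X l : MvPolynomial (Fin (i * j)) ℤ) * Polynomial.X)).coeff i)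
    (by
      intro e
      have h := Polynomial.coeff_map (p := ∏ L ∈ Finset.powersetCard j
        (Finset.univ : Finset (Fin (i * j))), (1 + Polynomial.C
        (∏ l ∈ L, X l : MvPolynomial (Fin (i * j)) ℤ) * Polynomial.X))
        (rename (R := ℤ) e : MvPolynomial (Fin (i * j)) ℤ →ₐ[ℤ] _).toRingHom i
      refine h.symm.trans ?_
      congr 1
      rw [Polynomial.map_prod]
      refine Finset.prod_bij' (fun L _ => L.map e.toEmbedding)
        (fun L _ => L.map e.symm.toEmbedding) ?_ ?_ ?_ ?_ ?_
      · intro L hL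
        simpa using hL
      · intro L hL
        simpa using hL
      · intro L _
        ext x; simp
      · intro L _
        ext x; simp
      · intro L _
        simp [Polynomial.map_prod])
  refine ⟨P, hP, fun P' hP' => ?_⟩
  have := esymmAlgHom_injective (σ := Fin (i * j)) ℤ (n := i * j) (by simp)
  apply this
  apply Subtype.ext
  rw [esymmAlgHom_apply, esymmAlgHom_apply]
  exact Eq.trans hP' hP.symm

/-- `∏_n (1 + y_n c) = 1 + ∑_{k ≥ 1} e_k(y) c^k`. -/
theorem prod_one_add_eq_esymm {A : Type*} [CommRing A] [Algebra ℤ A] {i : ℕ} (y : Fin i → A) (c : A) :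
    ∏ n : Fin i, (1 + y n * c) =
      1 + ∑ k : Fin i, aeval y (esymm (Fin i) ℤ (k + 1)) * c ^ (k + 1 : ℕ) := by
  rw [Finset.prod_one_add, Finset.sum_powerset, Finset.card_univ, Fintype.card_fin,
    Finset.sum_range_succ', add_comm, ← Fin.sum_univ_eq_sum_range
      (fun k => ∑ t ∈ Finset.powersetCard (k + 1) (Finset.univ : Finset (Fin i)),
        ∏ j ∈ t, y j * c)]
  congr 1
  · simp
  · refine Finset.sum_congr rfl fun k _ => ?_
    rw [esymm, map_sum, Finset.sum_mul]
    refine Finset.sum_congr rfl fun t ht => ?_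
    rw [Finset.mem_powersetCard] at ht
    rw [Finset.prod_mul_distrib, Finset.prod_const, ht.2, map_prod]
    simp

theorem prod_one_add_C_eq (i : ℕ) (m : Fin i) :
    ∏ n : Fin i, (1 + Polynomial.C (X (Sum.inl m) * X (Sum.inr n) :
      MvPolynomial (Fin i ⊕ Fin i) ℤ) * Polynomial.X) =
    1 + ∑ k : Fin i, Polynomial.C (rename (Sum.inr : Fin i → Fin i ⊕ Fin i)
      (esymm (Fin i) ℤ (k + 1))) * (Polynomial.C (X (Sum.inl m)) * Polynomial.X) ^ (k + 1 : ℕ) := by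
  have h := prod_one_add_eq_esymm (i := i)
      (fun n => Polynomial.C (X (Sum.inr n) : MvPolynomial (Fin i ⊕ Fin i) ℤ))
      (Polynomial.C (X (Sum.inl m)) * Polynomial.X)
  have h' : ∀ q : MvPolynomial (Fin i) ℤ,
      aeval (fun n => Polynomial.C (X (Sum.inr n) : MvPolynomial (Fin i ⊕ Fin i) ℤ)) q =
        Polynomial.C (rename (Sum.inr : Fin i → Fin i ⊕ Fin i) q) := by
    intro q
    induction q using MvPolynomial.induction_on with
    | C a => simp
    | add p q hp hq => simp only [map_add, hp, hq]
    | mul_X p n hp => simp only [map_mul, hp, aeval_X, rename_X]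
  simp only [h'] at h
  rw [← h]
  exact Finset.prod_congr rfl fun n _ => by rw [map_mul]; ring

/-- Substitution of the elementary symmetric functions in both groups of variables. -/
noncomputable def substEsymm (i : ℕ) :
    MvPolynomial (Fin i ⊕ Fin i) ℤ →ₐ[ℤ] MvPolynomial (Fin i ⊕ Fin i) ℤ :=
  aeval (Sum.elim
      (fun k : Fin i => rename (Sum.inl : Fin i → Fin i ⊕ Fin i) (esymm (Fin i) ℤ (k + 1)))
      (fun k : Fin i => rename (Sum.inr : Fin i → Fin i ⊕ Fin i) (esymm (Fin i) ℤ (k + 1))))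

theorem sumAlgEquiv_substEsymm (i : ℕ) (P : MvPolynomial (Fin i ⊕ Fin i) ℤ) :
    sumAlgEquiv ℤ (Fin i) (Fin i) (substEsymm i P) =
      aeval (fun k : Fin i => esymm (Fin i) (MvPolynomial (Fin i) ℤ) (k + 1))
        (MvPolynomial.map (RingHomClass.toRingHom
          (aeval (fun k : Fin i => esymm (Fin i) ℤ (k + 1)) :
            MvPolynomial (Fin i) ℤ →ₐ[ℤ] MvPolynomial (Fin i) ℤ))
          (sumAlgEquiv ℤ (Fin i) (Fin i) P)) := by
  have hr : ∀ q : MvPolynomial (Fin i) ℤ, sumAlgEquiv ℤ (Fin i) (Fin i)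
      (rename (Sum.inr : Fin i → Fin i ⊕ Fin i) q) = C q := by
    intro q
    induction q using MvPolynomial.induction_on with
    | C a => simp
    | add p q hp hq => simp only [map_add, hp, hq]
    | mul_X p n hp => simp only [map_mul, hp, rename_X, sumAlgEquiv_X_inr]
  induction P using MvPolynomial.induction_on with
  | C a => simp [substEsymm]
  | add p q hp hq => simp only [map_add, hp, hq]
  | mul_X p n hp =>
    simp only [map_mul, hp]
    congr 1
    cases n with
    | inl k =>
      simp only [substEsymm, aeval_X, Sum.elim_inl, sumAlgEquiv_X_inl, map_X]
      simp [esymm, map_sum, map_prod]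
    | inr k =>
      simp only [substEsymm, aeval_X, Sum.elim_inr, sumAlgEquiv_X_inr, map_C, hr]
      simp

theorem substEsymm_injective (i : ℕ) : Function.Injective (substEsymm i) := by
  have h1 : Function.Injective (aeval (fun k : Fin i => esymm (Fin i) ℤ (k + 1)) :
      MvPolynomial (Fin i) ℤ →ₐ[ℤ] MvPolynomial (Fin i) ℤ) := by
    intro p q h
    apply esymmAlgHom_injective (σ := Fin i) ℤ (n := i) (by simp)
    apply Subtype.ext
    rwa [esymmAlgHom_apply, esymmAlgHom_apply]
  have h2 : Function.Injective (aeval (fun k : Fin i =>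
      esymm (Fin i) (MvPolynomial (Fin i) ℤ) (k + 1)) :
      MvPolynomial (Fin i) (MvPolynomial (Fin i) ℤ) →ₐ[MvPolynomial (Fin i) ℤ] _) := by
    intro p q h
    apply esymmAlgHom_injective (σ := Fin i) (MvPolynomial (Fin i) ℤ) (n := i) (by simp)
    apply Subtype.ext
    rwa [esymmAlgHom_apply, esymmAlgHom_apply]
  intro P Q h
  have h' := congrArg (sumAlgEquiv ℤ (Fin i) (Fin i)) h
  rw [sumAlgEquiv_substEsymm, sumAlgEquiv_substEsymm] at h'
  exact (sumAlgEquiv ℤ (Fin i) (Fin i)).injective (map_injective _ h1 (h2 h'))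

theorem existsUnique_mulPoly (i : ℕ) : ∃! P, IsMulPoly i P := by
  let S := MvPolynomial (Fin i) ℤ
  let F : Polynomial (MvPolynomial (Fin i) S) :=
    ∏ m : Fin i, (1 + ∑ k : Fin i, Polynomial.C (C (X k : S)) *
      (Polynomial.C (X m : MvPolynomial (Fin i) S) * Polynomial.X) ^ (k + 1 : ℕ))
  obtain ⟨P, hP⟩ := exists_aeval_esymm (A := S) (n := i) (Q := F.coeff i) (by
    intro e
    have h := Polynomial.coeff_map (p := F)
        (rename (R := S) e : MvPolynomial (Fin i) S →ₐ[S] _).toRingHom i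
    refine h.symm.trans ?_
    congr 1
    rw [Polynomial.map_prod]
    refine Fintype.prod_equiv e _ _ fun m => ?_
    simp [Polynomial.map_sum])
  let φ : S →+* MvPolynomial (Fin i ⊕ Fin i) ℤ := RingHomClass.toRingHom
    (aeval (fun k : Fin i => rename (Sum.inr : Fin i → Fin i ⊕ Fin i) (esymm (Fin i) ℤ (k + 1))))
  have hφ : ∀ k, φ (X k) = rename (Sum.inr : Fin i → Fin i ⊕ Fin i) (esymm (Fin i) ℤ (k + 1)) :=
    fun k => by simp [φ, S]
  have h1 : eval₂Hom φ (fun m => X (Sum.inl m)) (F.coeff i) = (∏ m : Fin i, ∏ n : Fin i,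
      (1 + Polynomial.C (X (Sum.inl m) * X (Sum.inr n) : MvPolynomial (Fin i ⊕ Fin i) ℤ) *
        Polynomial.X)).coeff i := by
    rw [← Polynomial.coeff_map]
    congr 1
    rw [Polynomial.map_prod]
    refine Finset.prod_congr rfl fun m _ => ?_
    rw [prod_one_add_C_eq]
    simp only [Polynomial.map_add, Polynomial.map_one, Polynomial.map_sum, Polynomial.map_mul,
      Polynomial.map_pow, Polynomial.map_C, Polynomial.map_X, eval₂Hom_C, eval₂Hom_X', hφ]
  have h2 : ∀ Q : MvPolynomial (Fin i) S, substEsymm i ((sumAlgEquiv ℤ (Fin i) (Fin i)).symm Q) =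
      eval₂Hom φ (fun m => X (Sum.inl m))
        (aeval (R := S) (fun k : Fin i => esymm (Fin i) S (k + 1)) Q) := by
    intro Q
    induction Q using MvPolynomial.induction_on with
    | C a =>
      have hC : (sumAlgEquiv ℤ (Fin i) (Fin i)).symm (C a) = rename Sum.inr a := by
        rw [AlgEquiv.symm_apply_eq]
        induction a using MvPolynomial.induction_on with
        | C a => simp
        | add p q hp hq => simp only [map_add, hp, hq]
        | mul_X p n hp => simp only [map_mul, hp, rename_X, sumAlgEquiv_X_inr]
      rw [hC, aeval_C, algebraMap_eq, eval₂Hom_C, substEsymm, aeval_rename]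
      rfl
    | add p q hp hq => simp only [map_add, hp, hq]
    | mul_X p n hp =>
      simp only [map_mul, hp]
      congr 1
      have hX : (sumAlgEquiv ℤ (Fin i) (Fin i)).symm (X n) = X (Sum.inl n) :=
        sumAlgEquiv_symm_X ℤ _ _ n
      rw [hX, aeval_X, substEsymm, aeval_X, Sum.elim_inl]
      simp [esymm, map_sum, map_prod]
  refine ⟨(sumAlgEquiv ℤ (Fin i) (Fin i)).symm P, ?_, fun P' hP' => ?_⟩
  · exact (h2 P).trans (by rw [hP, h1])
  · apply substEsymm_injective
    refine Eq.trans hP' ?_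
    rw [h2 P, hP, h1]

/-- The universal polynomial `P_i`. -/
noncomputable def mulPoly (i : ℕ) : MvPolynomial (Fin i ⊕ Fin i) ℤ :=
  (existsUnique_mulPoly i).exists.choose

/-- The universal polynomial `P_{i,j}`. -/
noncomputable def compPoly (i j : ℕ) : MvPolynomial (Fin (i * j)) ℤ :=
  (existsUnique_compPoly i j).exists.choose

theorem mulPoly_spec (i : ℕ) : IsMulPoly i (mulPoly i) := (existsUnique_mulPoly i).exists.choose_spec

theorem compPoly_spec (i j : ℕ) : IsCompPoly i j (compPoly i j) :=
  (existsUnique_compPoly i j).exists.choose_spec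

/-! ### Lambda-rings and Adams operations -/

/-- A `λ`-ring structure (a "special" `λ`-ring structure in the older terminology) on a
commutative ring. -/
class LambdaRing (R : Type*) [CommRing R] where
  /-- The operation `λ^i`. -/
  lam : ℕ → R → R
  lam_zero : ∀ r, lam 0 r = 1
  lam_one : ∀ r, lam 1 r = r
  lam_of_one : ∀ i, 1 < i → lam i 1 = 0
  lam_add : ∀ i r s, lam i (r + s) = ∑ k ∈ Finset.range (i + 1), lam k r * lam (i - k) s
  lam_mul : ∀ i r s, lam i (r * s) =
    aeval (Sum.elim (fun k : Fin i => lam (k + 1) r) (fun k : Fin i => lam (k + 1) s)) (mulPoly i)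
  lam_lam : ∀ i j r, lam i (lam j r) =
    aeval (fun k : Fin (i * j) => lam (k + 1) r) (compPoly i j)

/-- The sequence `x_1, x_2, …` determined by a sequence `a_1, a_2, …` through the Newton formula
`x_n - a_1 x_{n-1} + ⋯ + (-1)^{n-1} a_{n-1} x_1 + (-1)^n n a_n = 0`; the value at `0` is a dummy. -/
def newton {A : Type*} [CommRing A] (a : ℕ → A) : ℕ → A
  | 0 => 0
  | n + 1 => (∑ k : Fin n, (-1) ^ (k : ℕ) * a (k + 1) * newton a (n - k)) +
      (-1) ^ n * (n + 1 : ℕ) * a (n + 1)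
  decreasing_by omega

theorem newton_formula {A : Type*} [CommRing A] {a : ℕ → A} (ha : a 0 = 1) {n : ℕ} (hn : 1 ≤ n) :
    (∑ k ∈ Finset.range n, (-1) ^ k * a k * newton a (n - k)) + (-1) ^ n * n * a n = 0 := by
  obtain ⟨n, rfl⟩ := Nat.exists_eq_add_of_le' hn
  rw [Finset.sum_range_succ', ← Fin.sum_univ_eq_sum_range
    (fun k => (-1) ^ (k + 1) * a (k + 1) * newton a (n + 1 - (k + 1))), ha]
  simp only [Nat.sub_zero, pow_zero, one_mul, Nat.add_sub_add_right]
  rw [newton]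
  simp only [pow_succ, mul_neg, mul_one, neg_mul, Finset.sum_neg_distrib]
  ring

theorem eq_newton {A : Type*} [CommRing A] {a : ℕ → A} (ha : a 0 = 1) {x : ℕ → A}
    (hx : ∀ n, 1 ≤ n →
      (∑ k ∈ Finset.range n, (-1) ^ k * a k * x (n - k)) + (-1) ^ n * n * a n = 0)
    {n : ℕ} (hn : 1 ≤ n) : x n = newton a n := by
  induction n using Nat.strong_induction_on with
  | _ n ih =>
    have h1 := hx n hn
    have h2 := newton_formula ha hn
    obtain ⟨n, rfl⟩ := Nat.exists_eq_add_of_le' hn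
    rw [Finset.sum_range_succ'] at h1 h2
    have h3 : ∑ k ∈ Finset.range n, (-1) ^ (k + 1) * a (k + 1) * x (n + 1 - (k + 1)) =
        ∑ k ∈ Finset.range n, (-1) ^ (k + 1) * a (k + 1) * newton a (n + 1 - (k + 1)) := by
      refine Finset.sum_congr rfl fun k hk => ?_
      rw [Finset.mem_range] at hk
      rw [ih (n + 1 - (k + 1)) (by omega) (by omega)]
    rw [h3] at h1
    simp only [Nat.sub_zero, pow_zero, one_mul, ha] at h1 h2
    linear_combination h1 - h2

theorem map_newton {A B : Type*} [CommRing A] [CommRing B] (φ : A →+* B) (a : ℕ → A) (n : ℕ) :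
    φ (newton a n) = newton (fun k => φ (a k)) n := by
  induction n using Nat.strong_induction_on with
  | _ n ih =>
    cases n with
    | zero => simp [newton]
    | succ n =>
      rw [newton, newton]
      simp only [map_add, map_sum, map_mul, map_pow, map_neg, map_one, map_natCast]
      congr 1
      refine Finset.sum_congr rfl fun k _ => ?_
      rw [ih (n - k) (by omega)]

theorem newton_congr {A : Type*} [CommRing A] {a b : ℕ → A} {n : ℕ}
    (h : ∀ k, 1 ≤ k → k ≤ n → a k = b k) : newton a n = newton b n := by
  induction n using Nat.strong_induction_on with
  | _ n ih =>
    cases n with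
    | zero => simp [newton]
    | succ n =>
      rw [newton, newton, h (n + 1) (by omega) le_rfl]
      congr 1
      refine Finset.sum_congr rfl fun k _ => ?_
      rw [ih (n - k) (by omega) fun l hl hl' => h l hl (by omega), h (k + 1) (by omega) (by omega)]

open PowerSeries in
/-- The Newton formula as the logarithmic derivative of the generating series. -/
theorem newton_powerSeries {A : Type*} [CommRing A] {a : ℕ → A} (ha : a 0 = 1) :
    PowerSeries.mk a * PowerSeries.mk (fun n => (-1) ^ n * newton a n) =
      -(PowerSeries.X * derivative A (PowerSeries.mk a)) := by
  ext n
  cases n with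
  | zero => simp [newton]
  | succ n =>
    rw [map_neg, PowerSeries.coeff_succ_X_mul, PowerSeries.coeff_derivative,
      PowerSeries.coeff_mul, Finset.Nat.sum_antidiagonal_eq_sum_range_succ_mk,
      Finset.sum_range_succ]
    have h := newton_formula ha (n := n + 1) (by omega)
    simp only [PowerSeries.coeff_mk, Nat.sub_self]
    have h3 : ∑ k ∈ Finset.range (n + 1), a k * ((-1) ^ (n + 1 - k) * newton a (n + 1 - k)) =
        (-1) ^ (n + 1) * ∑ k ∈ Finset.range (n + 1), (-1) ^ k * a k * newton a (n + 1 - k) := by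
      rw [Finset.mul_sum]
      refine Finset.sum_congr rfl fun k hk => ?_
      rw [Finset.mem_range] at hk
      obtain ⟨l, hl⟩ : ∃ l, n + 1 = k + l := ⟨n + 1 - k, by omega⟩
      rw [hl, Nat.add_sub_cancel_left, pow_add]
      have : ((-1 : A) ^ k) * (-1) ^ k = 1 := by rw [← pow_add, ← two_mul, pow_mul]; simp
      linear_combination -(a k * (-1) ^ l * newton a l) * this
    have h4 : ((-1 : A) ^ (n + 1)) * (-1) ^ (n + 1) = 1 := by
      rw [← pow_add, ← two_mul, pow_mul]; simp
    rw [h3]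
    simp only [newton, mul_zero, add_zero]
    push_cast at h
    linear_combination (-1) ^ (n + 1) * h - (n + 1) * a (n + 1) * h4

theorem newton_mul {A : Type*} [CommRing A] {a b c : ℕ → A} (ha : a 0 = 1) (hb : b 0 = 1)
    (hc : ∀ n, c n = ∑ k ∈ Finset.range (n + 1), a k * b (n - k)) (n : ℕ) :
    newton c n = newton a n + newton b n := by
  have hc0 : c 0 = 1 := by simp [hc, ha, hb]
  have hmul : PowerSeries.mk c = PowerSeries.mk a * PowerSeries.mk b := by
    ext m
    rw [PowerSeries.coeff_mul, Finset.Nat.sum_antidiagonal_eq_sum_range_succ_mk]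
    simp [hc]
  have h1 := newton_powerSeries ha
  have h2 := newton_powerSeries hb
  have h3 := newton_powerSeries hc0
  rw [hmul, Derivation.leibniz, smul_eq_mul, smul_eq_mul] at h3
  have hu : IsUnit (PowerSeries.mk a * PowerSeries.mk b) := by
    rw [PowerSeries.isUnit_iff_constantCoeff]
    rw [map_mul, ← PowerSeries.coeff_zero_eq_constantCoeff_apply,
      ← PowerSeries.coeff_zero_eq_constantCoeff_apply, PowerSeries.coeff_mk, PowerSeries.coeff_mk,
      ha, hb, one_mul]
    exact isUnit_one
  have key : PowerSeries.mk (fun n => (-1) ^ n * newton c n) =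
      PowerSeries.mk (fun n => (-1) ^ n * newton a n) +
        PowerSeries.mk (fun n => (-1) ^ n * newton b n) := by
    apply hu.mul_left_cancel
    linear_combination h3 - PowerSeries.mk b * h1 - PowerSeries.mk a * h2
  have := congrArg (PowerSeries.coeff n) key
  simp only [map_add, PowerSeries.coeff_mk] at this
  have h4 : ((-1 : A) ^ n) * (-1) ^ n = 1 := by
    rw [← pow_add, ← two_mul, pow_mul]; simp
  linear_combination (-1) ^ n * this - (newton c n - newton a n - newton b n) * h4

/-- Modulo a prime `p`, the `p`-th Newton polynomial is the `p`-th power of the first variable. -/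
theorem newton_prime_dvd {A : Type*} [CommRing A] (a : ℕ → A) {p : ℕ} (hp : p.Prime) :
    (p : A) ∣ newton a p - a 1 ^ p := by
  have : Fact p.Prime := ⟨hp⟩
  let v : (B : Type) → [CommRing B] → ℕ → MvPolynomial (Fin p) B := fun B _ k =>
    if h : k - 1 < p then X ⟨k - 1, h⟩ else 0
  have h0 : newton (v (ZMod p)) p = v (ZMod p) 1 ^ p := by
    apply esymmAlgHom_injective (σ := Fin p) (ZMod p) (n := p) (by simp)
    apply Subtype.ext
    rw [esymmAlgHom_apply, esymmAlgHom_apply, map_pow]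
    have e1 : aeval (fun k : Fin p => esymm (Fin p) (ZMod p) (k + 1)) (newton (v (ZMod p)) p) =
        newton (fun k => esymm (Fin p) (ZMod p) k) p := by
      refine (map_newton (A := MvPolynomial (Fin p) (ZMod p)) (RingHomClass.toRingHom
        (aeval (fun k : Fin p => esymm (Fin p) (ZMod p) (k + 1)))) _ _).trans ?_
      refine newton_congr fun k hk hk' => ?_
      have : k - 1 < p := by omega
      simp [v, this, Nat.sub_add_cancel hk]
    have e2 : psum (Fin p) (ZMod p) p = newton (fun k => esymm (Fin p) (ZMod p) k) p := by
      refine eq_newton (x := fun n => psum (Fin p) (ZMod p) n) (by simp) ?_ hp.one_le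
      intro n hn
      have h := mul_esymm_eq_sum (Fin p) (ZMod p) n
      have e3 : ∑ a ∈ Finset.HasAntidiagonal.antidiagonal n with a.1 < n,
          (-1) ^ a.1 * esymm (Fin p) (ZMod p) a.1 * psum (Fin p) (ZMod p) a.2 =
          ∑ k ∈ Finset.range n, (-1) ^ k * esymm (Fin p) (ZMod p) k *
            psum (Fin p) (ZMod p) (n - k) := by
        rw [Finset.sum_filter, Finset.Nat.sum_antidiagonal_eq_sum_range_succ_mk,
          Finset.sum_range_succ]
        simp only [lt_self_iff_false, if_false, add_zero]
        exact Finset.sum_congr rfl fun k hk => if_pos (Finset.mem_range.1 hk)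
      rw [e3] at h
      have h4 : ((-1 : MvPolynomial (Fin p) (ZMod p)) ^ n) * (-1) ^ n = 1 := by
        rw [← pow_add, ← two_mul, pow_mul]; simp
      rw [pow_succ] at h
      linear_combination (-1) ^ n * h - (∑ k ∈ Finset.range n, (-1) ^ k *
        esymm (Fin p) (ZMod p) k * psum (Fin p) (ZMod p) (n - k)) * h4
    rw [e1, ← e2]
    have : (0 : ℕ) < p := hp.pos
    simp [v, this, psum, esymm_one, sum_pow_char]
  have h1 : C (p : ℤ) ∣ newton (v ℤ) p - v ℤ 1 ^ p := by
    rw [C_dvd_iff_zmod, map_sub, map_pow, map_newton, sub_eq_zero]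
    have e : ∀ k, MvPolynomial.map (Int.castRingHom (ZMod p)) (v ℤ k) = v (ZMod p) k := by
      intro k
      simp only [v]
      split_ifs <;> simp
    simp only [e]
    exact h0
  have h2 := map_dvd (aeval (fun k : Fin p => a (k + 1)) : MvPolynomial (Fin p) ℤ →ₐ[ℤ] A) h1
  have e4 : aeval (fun k : Fin p => a (k + 1)) (newton (v ℤ) p) = newton a p := by
    refine (map_newton (A := MvPolynomial (Fin p) ℤ) (RingHomClass.toRingHom
      (aeval (fun k : Fin p => a (k + 1)) : MvPolynomial (Fin p) ℤ →ₐ[ℤ] A)) _ _).trans ?_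
    refine newton_congr fun k hk hk' => ?_
    have : k - 1 < p := by omega
    simp [v, this, Nat.sub_add_cancel hk]
  rw [map_sub, map_pow, e4] at h2
  have : (0 : ℕ) < p := hp.pos
  simpa [v, this] using h2

variable (R : Type*) [CommRing R] [LambdaRing R]

/-- The Adams operation `ψ^n` (`n ≥ 1`), defined from the `λ`-operations by the Newton formula; it
is additive, hence a `ℤ`-linear endomorphism of `R`. -/
def adams (n : ℕ+) : Module.End ℤ R :=
  AddMonoidHom.toIntLinearMap
    (AddMonoidHom.mk' (fun r => newton (fun i => LambdaRing.lam i r) n) fun r s =>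
      newton_mul (LambdaRing.lam_zero r) (LambdaRing.lam_zero s)
        (fun i => LambdaRing.lam_add i r s) n)

theorem adams_apply (n : ℕ+) (r : R) :
    adams R n r = newton (fun i => LambdaRing.lam i r) n := rfl

theorem adams_prime_dvd {p : ℕ+} (hp : (p : ℕ).Prime) (r : R) :
    ((p : ℕ) : R) ∣ adams R p r - r ^ (p : ℕ) := by
  have h := newton_prime_dvd (fun i => LambdaRing.lam i r) hp
  rwa [LambdaRing.lam_one] at h

/-! ### The cochain complex in degrees `0, 1, 2` -/

/-- The additive group `F⁰` of `ℤ`-linear endomorphisms `f` of `R` with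
`f(r)^p ≡ f(r^p) (mod pR)` for every prime `p` and every `r`. -/
def F0 : AddSubgroup (Module.End ℤ R) where
  carrier := {f | ∀ p : ℕ, p.Prime → ∀ r : R, (p : R) ∣ f r ^ p - f (r ^ p)}
  zero_mem' := by
    intro p hp r
    simp [hp.ne_zero]
  add_mem' := by
    intro f g hf hg p hp r
    obtain ⟨c, hc⟩ := exists_add_pow_prime_eq hp (f r) (g r)
    have := ((hf p hp r).add (hg p hp r)).add (Dvd.intro (f r * g r * c) rfl : (p : R) ∣ _)
    refine this.trans (dvd_of_eq ?_)
    simp only [LinearMap.add_apply]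
    rw [hc]
    ring
  neg_mem' := by
    intro f hf p hp r
    obtain ⟨c, hc⟩ := exists_add_pow_prime_eq hp (f r) (-f r)
    rw [add_neg_cancel, zero_pow hp.ne_zero] at hc
    have := (hf p hp r).add (Dvd.intro (f r * -f r * c) rfl : (p : R) ∣ _)
    rw [← dvd_neg] at this
    refine this.trans (dvd_of_eq ?_)
    simp only [LinearMap.neg_apply]
    linear_combination hc

/-- The additive group `F¹` of functions `f` from the positive integers to the `ℤ`-linear
endomorphisms of `R` with `f(p)(R) ⊆ pR` for every prime `p`. -/
def F1 : AddSubgroup (ℕ+ → Module.End ℤ R) where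
  carrier := {f | ∀ p : ℕ+, (p : ℕ).Prime → ∀ r : R, ((p : ℕ) : R) ∣ f p r}
  zero_mem' := fun _ _ _ => dvd_zero _
  add_mem' := fun hf hg p hp r => (hf p hp r).add (hg p hp r)
  neg_mem' := fun hf p hp r => (hf p hp r).neg_right

/-- The additive group `F²` of functions from pairs of positive integers to the `ℤ`-linear
endomorphisms of `R`. -/
abbrev F2 : Type _ := ℕ+ → ℕ+ → Module.End ℤ R

/-- The differential `d⁰ g (n) = ψ^n g - g ψ^n`. -/
def d0 : F0 R →+ F1 R where
  toFun g := ⟨fun n => adams R n * (g : Module.End ℤ R) - (g : Module.End ℤ R) * adams R n, by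
    intro p hp r
    have h1 := adams_prime_dvd R hp ((g : Module.End ℤ R) r)
    have h2 := g.2 p hp r
    obtain ⟨c, hc⟩ := adams_prime_dvd R hp r
    have h3 : ((p : ℕ) : R) ∣ (g : Module.End ℤ R) (adams R p r - r ^ (p : ℕ)) := by
      rw [hc, ← nsmul_eq_mul, map_nsmul, nsmul_eq_mul]
      exact Dvd.intro _ rfl
    rw [map_sub] at h3
    refine ((h1.add h2).sub h3).trans (dvd_of_eq ?_)
    simp only [LinearMap.sub_apply, Module.End.mul_apply]
    ring⟩
  map_zero' := by
    ext n r
    simp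
  map_add' g h := by
    apply Subtype.ext
    funext n
    simp only [AddSubgroup.coe_add, Pi.add_apply, mul_add, add_mul]
    abel

/-- The differential `d¹ f (m, n) = ψ^m f(n) - f(mn) + f(m) ψ^n`. -/
def d1 : F1 R →+ F2 R where
  toFun f := fun m n => adams R m * f.1 n - f.1 (m * n) + f.1 m * adams R n
  map_zero' := by
    ext m n r
    simp
  map_add' f g := by
    funext m n
    simp only [AddSubgroup.coe_add, Pi.add_apply, mul_add, add_mul]
    abel

/-- The group `Der_λ(R)` of `λ`-derivations, i.e. of `1`-cocycles. -/
abbrev Der : AddSubgroup (F1 R) := (d1 R).ker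

theorem mem_Der_iff (f : F1 R) :
    f ∈ Der R ↔ ∀ m n : ℕ+, f.1 (m * n) = adams R m * f.1 n + f.1 m * adams R n := by
  rw [AddMonoidHom.mem_ker]
  constructor
  · intro h m n
    have := congrFun (congrFun h m) n
    change adams R m * f.1 n - f.1 (m * n) + f.1 m * adams R n = 0 at this
    rw [← sub_eq_zero, ← neg_eq_zero, ← this]
    abel
  · intro h
    funext m n
    change adams R m * f.1 n - f.1 (m * n) + f.1 m * adams R n = 0
    rw [h m n]
    abel

/-- The group `Inn_λ(R)` of `λ`-inner derivations `[ψ^*, g]`, i.e. of `1`-coboundaries. -/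
abbrev Inn : AddSubgroup (F1 R) := (d0 R).range

/-- The first `λ`-ring cohomology group: `1`-cocycles modulo `1`-coboundaries. -/
abbrev H1 : Type _ := Der R ⧸ (Inn R).addSubgroupOf (Der R)

/-! ### The version indexed by the primes -/

/-- The group of sequences `(f(p))` of `ℤ`-linear endomorphisms of `R`, indexed by the primes, with
`f(p)(R) ⊆ pR` and `ψ^p f(q) + f(p) ψ^q = ψ^q f(p) + f(q) ψ^p`. -/
def DerBar : AddSubgroup (Nat.Primes → Module.End ℤ R) where
  carrier := {f | (∀ (p : Nat.Primes) (r : R), ((p : ℕ) : R) ∣ f p r) ∧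
    ∀ p q : Nat.Primes, adams R p * f q + f p * adams R q = adams R q * f p + f q * adams R p}
  zero_mem' := ⟨fun _ _ => dvd_zero _, fun _ _ => by simp⟩
  add_mem' := by
    rintro f g ⟨hf, hf'⟩ ⟨hg, hg'⟩
    refine ⟨fun p r => (hf p r).add (hg p r), fun p q => ?_⟩
    have := congrArg₂ (· + ·) (hf' p q) (hg' p q)
    simp only [Pi.add_apply, mul_add, add_mul] at this ⊢
    convert this using 1 <;> abel
  neg_mem' := by
    rintro f ⟨hf, hf'⟩
    refine ⟨fun p r => (hf p r).neg_right, fun p q => ?_⟩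
    have := congrArg (fun x => -x) (hf' p q)
    simpa only [Pi.neg_apply, mul_neg, neg_mul, neg_add] using this

/-- The group of sequences `([ψ^p, g])`, indexed by the primes, with `g ∈ F⁰`. -/
def InnBar : AddSubgroup (Nat.Primes → Module.End ℤ R) :=
  AddMonoidHom.range (G := F0 R)
    { toFun := fun g p => adams R p * (g : Module.End ℤ R) - (g : Module.End ℤ R) * adams R p
      map_zero' := by
        ext p r
        simp
      map_add' := fun g h => by
        funext p
        simp only [AddSubgroup.coe_add, Pi.add_apply, mul_add, add_mul]
        abel }

/-- The quotient group of `DerBar R` by its subgroup `InnBar R`. -/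
abbrev H1Bar : Type _ := DerBar R ⧸ (InnBar R).addSubgroupOf (DerBar R)

/-- The restriction `f ↦ (f(p))_p` of a `λ`-derivation to the primes. -/
def restrictPrimes : Der R →+ DerBar R where
  toFun f := ⟨fun p => f.1.1 p, fun p r => f.1.2 p p.2 r, fun p q => by
    have h := (mem_Der_iff R f.1).1 f.2
    rw [← h p q, mul_comm, h q p]⟩
  map_zero' := rfl
  map_add' _ _ := rfl

end LambdaCohomology

namespace LambdaCohomology

open MvPolynomial

/-! The cocycle condition on `f` says exactly that `n ↦ (ψ^n, f(n))` is multiplicative, as a map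
from the positive integers to the square-zero extension of `End(R)` by itself (`derHom`). The
positive integers form the free commutative monoid on the primes. Hence such a homomorphism is
determined by its values at the primes (`pnat_monoidHom_ext`), and any pairwise commuting values
extend (`exists_pnat_monoidHom`). Commutation of the pairs `(ψ^p, f(p))` is the condition defining
`DerBar`, and the divisibility condition in `F1` concerns primes only. So restriction is an
isomorphism already from `Der` onto `DerBar`. It carries `Inn` onto `InnBar`, and the quotients are
isomorphic.

This rests on `ψ^1 = id` and `ψ^m ψ^n = ψ^{mn}`, and most of the work lies in deriving the latter
from the axioms of a `λ`-ring. The argument is a splitting principle. An identity between universal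
polynomials may be checked after substituting elementary symmetric functions, because that
substitution is injective. There Newton's formula produces power sums (`newton_elemSymm`), for which
the identities are evident. Since `P_i` and `P_{i,j}` are defined with a fixed number of variables,
they must first be shown to keep their meaning in more variables (`aeval_mulPoly`,
`aeval_compPoly`). -/

/-! ### Elementary symmetric functions of finite families -/

section ElemSymm

variable {A B α β : Type*} [CommRing A] [CommRing B]

/-- The `i`-th elementary symmetric function of the family `x` indexed by `s`. -/
noncomputable def elemSymm (s : Finset α) (x : α → A) (i : ℕ) : A :=
  (∏ a ∈ s, (1 + Polynomial.C (x a) * Polynomial.X)).coeff i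

theorem elemSymm_eq_sum (s : Finset α) (x : α → A) (i : ℕ) :
    elemSymm s x i = ∑ t ∈ s.powersetCard i, ∏ a ∈ t, x a := by
  rw [elemSymm, Finset.prod_one_add, Polynomial.finsetSum_coeff, ← Finset.sum_filter_add_sum_filter_not
    s.powerset (fun t => t.card = i), ← Finset.powersetCard_eq_filter]
  have h : ∀ t : Finset α, (∏ a ∈ t, (Polynomial.C (x a) * Polynomial.X)).coeff i =
      if t.card = i then ∏ a ∈ t, x a else 0 := by
    intro t
    rw [Finset.prod_mul_distrib, Finset.prod_const, ← map_prod, Polynomial.coeff_C_mul_X_pow]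
    simp only [eq_comm]
  rw [Finset.sum_congr rfl fun t ht => (h t).trans (if_pos (Finset.mem_powersetCard.1 ht).2),
    Finset.sum_eq_zero fun t ht => (h t).trans (if_neg (Finset.mem_filter.1 ht).2), add_zero]

theorem elemSymm_zero (s : Finset α) (x : α → A) : elemSymm s x 0 = 1 := by
  simp [elemSymm_eq_sum]

theorem map_elemSymm (φ : A →+* B) (s : Finset α) (x : α → A) (i : ℕ) :
    φ (elemSymm s x i) = elemSymm s (fun a => φ (x a)) i := by
  simp [elemSymm_eq_sum, map_sum, map_prod]

theorem aeval_esymm_eq_elemSymm [Algebra ℤ A] {n : ℕ} (x : Fin n → A) (i : ℕ) :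
    aeval x (esymm (Fin n) ℤ i) = elemSymm Finset.univ x i := by
  simp [esymm, elemSymm_eq_sum, map_sum, map_prod]

/-- A vanishing member contributes the factor `1` to the generating product. This describes the
effect of setting some variables to zero. -/
theorem elemSymm_eq_of_injOn {s : Finset α} {t : Finset β} {x : α → A} {y : β → A} (h : α → β)
    (hinj : Set.InjOn h s) (hmaps : Set.MapsTo h s t) (hxy : ∀ a ∈ s, y (h a) = x a)
    (hzero : ∀ b ∈ t, b ∉ h '' s → y b = 0) (i : ℕ) : elemSymm t y i = elemSymm s x i := by
  rw [elemSymm, elemSymm, Finset.prod_of_injOn h hinj hmaps]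
  · intro b hb hb'
    simp [hzero b hb hb']
  · intro a ha
    rw [hxy a ha]

theorem newton_one_X (x : A) (n : ℕ) :
    newton (fun i => (1 + Polynomial.C x * Polynomial.X).coeff i) (n + 1) = x ^ (n + 1) := by
  induction n with
  | zero => simp [newton, Polynomial.coeff_one]
  | succ n ih =>
    rw [newton, Fin.sum_univ_succ]
    simp only [Fin.val_zero, Nat.sub_zero, ih]
    simp [Polynomial.coeff_one, Polynomial.coeff_X]
    ring

/-- The generating polynomial is a product of linear factors, and `newton_mul` turns products into
sums, so one factor `1 + xt` at a time suffices. -/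
theorem newton_elemSymm (s : Finset α) (x : α → A) {n : ℕ} (hn : 1 ≤ n) :
    newton (elemSymm s x) n = ∑ a ∈ s, x a ^ n := by
  classical
  obtain ⟨n, rfl⟩ := Nat.exists_eq_add_of_le' hn
  induction s using Finset.induction_on with
  | empty =>
    -- From `1 * 1 = 1` the Newton value `v` of the empty family satisfies `v = v + v`, so it
    -- vanishes.
    have h := newton_mul (A := A) (a := elemSymm (∅ : Finset α) x) (b := elemSymm (∅ : Finset α) x)
      (c := elemSymm (∅ : Finset α) x) (elemSymm_zero _ _) (elemSymm_zero _ _) (fun n => by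
        have := Polynomial.coeff_mul (1 : Polynomial A) 1 n
        rw [Finset.Nat.sum_antidiagonal_eq_sum_range_succ_mk, mul_one] at this
        simpa [elemSymm] using this) (n + 1)
    simpa using h
  | insert a s ha ih =>
    have h := newton_mul (A := A) (a := fun i => (1 + Polynomial.C (x a) * Polynomial.X).coeff i)
      (b := elemSymm s x) (c := elemSymm (insert a s) x) (by simp) (elemSymm_zero _ _)
      (fun n => by
        rw [elemSymm, Finset.prod_insert ha, Polynomial.coeff_mul,
          Finset.Nat.sum_antidiagonal_eq_sum_range_succ_mk]
        rfl) (n + 1)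
    rw [h, ih, newton_one_X, Finset.sum_insert ha]

end ElemSymm

theorem ringHom_aeval {σ A B : Type*} [CommRing A] [CommRing B] [Algebra ℤ A] [Algebra ℤ B]
    (φ : A →+* B) (g : σ → A) (P : MvPolynomial σ ℤ) :
    φ (aeval g P) = aeval (fun k => φ (g k)) P := by
  rw [map_aeval, aeval_def, ← coe_eval₂Hom]
  exact congrArg (fun ψ => eval₂Hom ψ (fun k => φ (g k)) P) (RingHom.ext_int _ _)

/-! ### Weighted homogeneity and restriction of variables -/

section Weighted

variable {σ τ M : Type*} [AddCommMonoid M]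

theorem isWeightedHomogeneous_elemSymm {α : Type*} {w : τ → M} {s : Finset α}
    {x : α → MvPolynomial τ ℤ} {c : M} (hx : ∀ a ∈ s, IsWeightedHomogeneous w (x a) c) (i : ℕ) :
    IsWeightedHomogeneous w (elemSymm s x i) (i • c) := by
  rw [elemSymm_eq_sum]
  refine IsWeightedHomogeneous.sum _ _ _ fun t ht => ?_
  rw [Finset.mem_powersetCard] at ht
  have := IsWeightedHomogeneous.prod t x (fun _ => c) fun a ha => hx a (ht.1 ha)
  rwa [Finset.sum_const, ht.2] at this

theorem isWeightedHomogeneous_aeval [Fintype σ] {w : σ → M} {w' : τ → M} {s : σ → MvPolynomial τ ℤ}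
    (hs : ∀ k, IsWeightedHomogeneous w' (s k) (w k)) {P : MvPolynomial σ ℤ} {m : M}
    (hP : IsWeightedHomogeneous w P m) : IsWeightedHomogeneous w' (aeval s P) m := by
  rw [aeval_def, eval₂_eq']
  refine IsWeightedHomogeneous.sum _ _ _ fun d hd => ?_
  have h : Finsupp.weight w d = m := hP (mem_support_iff.1 hd)
  have h1 := IsWeightedHomogeneous.prod Finset.univ (fun k => s k ^ d k) (fun k => d k • w k)
    fun k _ => (hs k).pow (d k)
  have h2 : ∑ k, d k • w k = m := by
    rw [← h, Finsupp.weight_apply, Finsupp.sum_fintype _ _ (by simp)]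
  rw [h2] at h1
  exact h1.C_mul _

/-- The substitution sends the weighted components of `P` to those of its image. If the image has a
single component, injectivity forces `P` to equal its component of that weight. -/
theorem isWeightedHomogeneous_of_aeval [Fintype σ] {w : σ → M} {w' : τ → M}
    {s : σ → MvPolynomial τ ℤ} (hs : ∀ k, IsWeightedHomogeneous w' (s k) (w k))
    (hinj : Function.Injective (aeval s : MvPolynomial σ ℤ →ₐ[ℤ] MvPolynomial τ ℤ))
    {P : MvPolynomial σ ℤ} {m : M} (hP : IsWeightedHomogeneous w' (aeval s P) m) :
    IsWeightedHomogeneous w P m := by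
  classical
  have hcomp : ∀ n, IsWeightedHomogeneous w' (aeval s (weightedHomogeneousComponent w n P)) n :=
    fun n => isWeightedHomogeneous_aeval hs (weightedHomogeneousComponent_isWeightedHomogeneous n P)
  have hfin := weightedHomogeneousComponent_finsupp (w := w) P
  have hsum : aeval s P = ∑ n ∈ hfin.toFinset, aeval s (weightedHomogeneousComponent w n P) := by
    rw [← map_sum]
    conv_lhs => rw [← sum_weightedHomogeneousComponent w P]
    rw [finsum_eq_sum _ hfin]
  have hm : aeval s P = aeval s (weightedHomogeneousComponent w m P) := by
    rw [← weightedHomogeneousComponent_eq_self hP]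
    conv_lhs => rw [hsum]
    rw [map_sum]
    rw [Finset.sum_eq_single m]
    · exact weightedHomogeneousComponent_eq_self (hcomp m)
    · intro n _ hn
      exact (hcomp n).weightedHomogeneousComponent_ne m hn.symm
    · intro h
      have h0 : weightedHomogeneousComponent w m P = 0 := by
        by_contra h0
        exact h ((Set.Finite.mem_toFinset hfin).2 h0)
      rw [h0, map_zero, map_zero]
  rw [hinj hm]
  exact weightedHomogeneousComponent_isWeightedHomogeneous m P

theorem coeff_killCompl {f : σ → τ} (hf : Function.Injective f) (p : MvPolynomial τ ℤ)
    (d : σ →₀ ℕ) : coeff d (killCompl hf p) = coeff (d.mapDomain f) p := by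
  classical
  induction p using MvPolynomial.induction_on' with
  | monomial e c =>
    by_cases he : (e.support : Set τ) ⊆ Set.range f
    · obtain ⟨e, rfl⟩ : ∃ e', e = Finsupp.mapDomain f e' :=
        ⟨_, (Finsupp.mapDomain_comapDomain f hf e he).symm⟩
      rw [killCompl_monomial_mapDomain, coeff_monomial, coeff_monomial]
      simp only [(Finsupp.mapDomain_injective hf).eq_iff]
    · rw [killCompl_monomial_eq_zero_of_not_subset hf c he, coeff_zero, coeff_monomial, if_neg]
      rintro rfl
      apply he
      intro a ha
      obtain ⟨x, -, hx⟩ := Finset.mem_image.1 (Finsupp.mapDomain_support ha)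
      exact ⟨x, hx⟩
  | add p q hp hq => rw [map_add, coeff_add, hp, hq, coeff_add]

/-- Setting to zero variables absent from a monomial preserves its coefficient, so each monomial of
`D` would survive in a specialisation that is zero. -/
theorem eq_zero_of_killCompl {D : MvPolynomial τ ℤ}
    (h : ∀ d ∈ D.support, ∃ (f : σ → τ) (hf : Function.Injective f),
      (d.support : Set τ) ⊆ Set.range f ∧ killCompl hf D = 0) : D = 0 := by
  ext d
  by_contra hd
  obtain ⟨f, hf, hdf, hD⟩ := h d (mem_support_iff.2 hd)
  apply hd
  rw [← Finsupp.mapDomain_comapDomain f hf d hdf, ← coeff_killCompl hf, hD]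
  simp

theorem exists_injective_subset_range {N n : ℕ} (hn : n ≤ N) {s : Finset (Fin N)}
    (hs : s.card ≤ n) : ∃ f : Fin n → Fin N, Function.Injective f ∧ (s : Set (Fin N)) ⊆ Set.range f := by
  obtain ⟨t, hst, ht⟩ := Finset.exists_superset_card_eq hs (by simpa using hn)
  refine ⟨t.orderEmbOfFin ht, (t.orderEmbOfFin ht).injective, ?_⟩
  rw [Finset.range_orderEmbOfFin]
  exact_mod_cast hst

end Weighted

/-! ### Independence of the universal polynomials from the number of variables -/

section Stability

theorem killCompl_X_apply {σ τ : Type*} {f : σ → τ} (hf : Function.Injective f) (a : σ) :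
    killCompl hf (X (f a) : MvPolynomial τ ℤ) = X a := by
  rw [← rename_X, killCompl_rename_app]

theorem killCompl_X_of_notMem {σ τ : Type*} {f : σ → τ} (hf : Function.Injective f) {b : τ}
    (hb : b ∉ Set.range f) : killCompl hf (X b : MvPolynomial τ ℤ) = 0 := by
  simp [killCompl, hb]

theorem killCompl_elemSymm {σ τ α : Type*} {f : σ → τ} (hf : Function.Injective f) (s : Finset α)
    (x : α → MvPolynomial τ ℤ) (i : ℕ) :
    killCompl hf (elemSymm s x i) = elemSymm s (fun a => killCompl hf (x a)) i :=
  map_elemSymm (killCompl hf : MvPolynomial τ ℤ →ₐ[ℤ] _).toRingHom s x i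

theorem killCompl_aeval {ι σ τ : Type*} {f : σ → τ} (hf : Function.Injective f)
    (g : ι → MvPolynomial τ ℤ) (P : MvPolynomial ι ℤ) :
    killCompl hf (aeval g P) = aeval (fun k => killCompl hf (g k)) P :=
  ringHom_aeval (killCompl hf : MvPolynomial τ ℤ →ₐ[ℤ] MvPolynomial σ ℤ).toRingHom g P

theorem aeval_esymm_injective (n : ℕ) :
    Function.Injective (aeval (fun k : Fin n => elemSymm Finset.univ X (k + 1)) :
      MvPolynomial (Fin n) ℤ →ₐ[ℤ] MvPolynomial (Fin n) ℤ) := by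
  intro p q h
  apply esymmAlgHom_injective (σ := Fin n) ℤ (n := n) (by simp)
  apply Subtype.ext
  rw [esymmAlgHom_apply, esymmAlgHom_apply]
  simpa only [← aeval_esymm_eq_elemSymm, aeval_X_left_apply] using h

/-! ### The polynomials `P_{i,j}` in more variables -/

theorem aeval_compPoly_self (i j : ℕ) :
    aeval (fun k : Fin (i * j) => elemSymm Finset.univ X (k + 1)) (compPoly i j) =
      elemSymm (Finset.powersetCard j (Finset.univ : Finset (Fin (i * j))))
        (fun L => ∏ l ∈ L, (X l : MvPolynomial (Fin (i * j)) ℤ)) i := by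
  have h := compPoly_spec i j
  unfold IsCompPoly at h
  simp only [← aeval_esymm_eq_elemSymm, aeval_X_left_apply]
  exact h

theorem isWeightedHomogeneous_elemSymm_comp (i j N : ℕ) :
    IsWeightedHomogeneous (fun _ => 1) (elemSymm (Finset.powersetCard j
      (Finset.univ : Finset (Fin N))) (fun L => ∏ l ∈ L, (X l : MvPolynomial (Fin N) ℤ)) i)
      (i * j) := by
  rw [← smul_eq_mul]
  refine isWeightedHomogeneous_elemSymm (fun L hL => ?_) i
  have := IsWeightedHomogeneous.prod L (fun l => (X l : MvPolynomial (Fin N) ℤ)) (fun _ => 1)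
    (w := fun _ => 1) fun l _ => isWeightedHomogeneous_X ℤ _ l
  simpa [(Finset.mem_powersetCard.1 hL).2] using this

theorem isWeightedHomogeneous_elemSymm_X (N i : ℕ) :
    IsWeightedHomogeneous (fun _ => 1)
      (elemSymm Finset.univ (X : Fin N → MvPolynomial (Fin N) ℤ) i) i := by
  convert isWeightedHomogeneous_elemSymm (w := fun _ => 1) (c := 1) (s := Finset.univ)
    (x := (X : Fin N → MvPolynomial (Fin N) ℤ)) (fun a _ => isWeightedHomogeneous_X ℤ _ a) i using 1
  exact (mul_one i).symm

/-- Both sides are homogeneous of degree `ij`, so a monomial of their difference involves at most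
`ij` variables. Setting the remaining variables to zero leads back to the defining identity of
`P_{i,j}`. -/
theorem aeval_compPoly {i j N : ℕ} (hN : i * j ≤ N) :
    aeval (fun k : Fin (i * j) => elemSymm Finset.univ X (k + 1)) (compPoly i j) =
      elemSymm (Finset.powersetCard j (Finset.univ : Finset (Fin N)))
        (fun L => ∏ l ∈ L, (X l : MvPolynomial (Fin N) ℤ)) i := by
  classical
  have hhom : IsWeightedHomogeneous (fun k : Fin (i * j) => (k + 1 : ℕ)) (compPoly i j) (i * j) := by
    refine isWeightedHomogeneous_of_aeval
      (fun k : Fin (i * j) => isWeightedHomogeneous_elemSymm_X (i * j) (k + 1)) (aeval_esymm_injective _) ?_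
    rw [aeval_compPoly_self]
    exact isWeightedHomogeneous_elemSymm_comp i j _
  rw [← sub_eq_zero]
  have hD := (isWeightedHomogeneous_aeval
    (fun k : Fin (i * j) => isWeightedHomogeneous_elemSymm_X N (k + 1)) hhom).sub
      (isWeightedHomogeneous_elemSymm_comp i j N)
  refine eq_zero_of_killCompl (σ := Fin (i * j)) fun d hd => ?_
  have hcard : d.support.card ≤ i * j := by
    have h : Finsupp.weight (fun _ => 1) d = i * j := hD (mem_support_iff.1 hd)
    rw [← h, Finsupp.weight_apply, Finset.card_eq_sum_ones]
    refine Finset.sum_le_sum fun k hk => ?_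
    have := Finsupp.mem_support_iff.1 hk
    simp only [smul_eq_mul, mul_one]
    omega
  obtain ⟨f, hf, hdf⟩ := exists_injective_subset_range hN hcard
  refine ⟨f, hf, hdf, ?_⟩
  have hX : ∀ k, killCompl hf (elemSymm Finset.univ (X : Fin N → MvPolynomial (Fin N) ℤ) k) =
      elemSymm Finset.univ X k := by
    intro k
    rw [killCompl_elemSymm]
    refine elemSymm_eq_of_injOn f hf.injOn (by simp [Set.MapsTo]) (fun a _ => ?_)
      (fun b _ hb => ?_) k
    · exact killCompl_X_apply hf a
    · exact killCompl_X_of_notMem hf (by simpa using hb)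
  have hL : killCompl hf (elemSymm (Finset.powersetCard j (Finset.univ : Finset (Fin N)))
      (fun L => ∏ l ∈ L, (X l : MvPolynomial (Fin N) ℤ)) i) =
      elemSymm (Finset.powersetCard j (Finset.univ : Finset (Fin (i * j))))
        (fun L => ∏ l ∈ L, (X l : MvPolynomial (Fin (i * j)) ℤ)) i := by
    rw [killCompl_elemSymm]
    refine elemSymm_eq_of_injOn (Finset.map ⟨f, hf⟩) (Finset.map_injective _).injOn
      (fun L hL => ?_) (fun L _ => ?_) (fun L hL hL' => ?_) i
    · simpa using hL
    · simp only [map_prod, Finset.prod_map, Function.Embedding.coeFn_mk, killCompl_X_apply]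
    -- A set contained in the range of `f` is the image of its preimage; any other `L` contains a
    -- killed variable, and its product vanishes.
    · obtain ⟨l, hl, hlf⟩ : ∃ l ∈ L, l ∉ Set.range f := by
        by_contra! h
        obtain ⟨K, rfl⟩ : ∃ K : Finset (Fin (i * j)), L = K.map ⟨f, hf⟩ := by
          refine ⟨Finset.univ.filter fun k => f k ∈ L, ?_⟩
          ext l
          simp only [Finset.mem_map, Finset.mem_filter, Finset.mem_univ, true_and,
            Function.Embedding.coeFn_mk]
          constructor
          · intro hl
            obtain ⟨k, rfl⟩ := h l hl
            exact ⟨k, hl, rfl⟩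
          · rintro ⟨k, hk, rfl⟩
            exact hk
        exact hL' ⟨K, by simpa using hL, rfl⟩
      rw [map_prod]
      exact Finset.prod_eq_zero hl (killCompl_X_of_notMem hf hlf)
  rw [map_sub, sub_eq_zero, killCompl_aeval, hL, ← aeval_compPoly_self]
  simp only [hX]

/-! ### The polynomials `P_i` in more variables -/

/-- The bidegree on polynomials in two groups of variables. -/
def biweight (N : ℕ) : Fin N ⊕ Fin N → ℕ × ℕ :=
  Sum.elim (fun _ => (1, 0)) (fun _ => (0, 1))

/-- The elementary symmetric functions of each of two groups of variables. -/
noncomputable def biElemSymm (N i : ℕ) : Fin i ⊕ Fin i → MvPolynomial (Fin N ⊕ Fin N) ℤ :=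
  Sum.elim (fun k => elemSymm Finset.univ (fun m => X (Sum.inl m)) (k + 1))
    (fun k => elemSymm Finset.univ (fun m => X (Sum.inr m)) (k + 1))

theorem rename_esymm_eq_elemSymm {N : ℕ} (e : Fin N → Fin N ⊕ Fin N) (k : ℕ) :
    rename e (esymm (Fin N) ℤ k) = elemSymm Finset.univ (fun m => X (e m)) k := by
  simp [esymm, elemSymm_eq_sum, map_sum, map_prod]

theorem substEsymm_eq_aeval (i : ℕ) : substEsymm i = aeval (biElemSymm i i) := by
  simp only [substEsymm, biElemSymm, rename_esymm_eq_elemSymm]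

theorem aeval_mulPoly_self (i : ℕ) :
    aeval (biElemSymm i i) (mulPoly i) =
      elemSymm (Finset.univ : Finset (Fin i × Fin i))
        (fun a => (X (Sum.inl a.1) * X (Sum.inr a.2) : MvPolynomial (Fin i ⊕ Fin i) ℤ)) i := by
  rw [elemSymm, Fintype.prod_prod_type, ← substEsymm_eq_aeval]
  exact mulPoly_spec i

theorem isWeightedHomogeneous_elemSymm_mul (i N : ℕ) :
    IsWeightedHomogeneous (biweight N) (elemSymm (Finset.univ : Finset (Fin N × Fin N))
      (fun a => (X (Sum.inl a.1) * X (Sum.inr a.2) : MvPolynomial (Fin N ⊕ Fin N) ℤ)) i)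
      (i, i) := by
  have := isWeightedHomogeneous_elemSymm (w := biweight N) (c := (1, 1))
    (s := (Finset.univ : Finset (Fin N × Fin N)))
    (x := fun a => (X (Sum.inl a.1) * X (Sum.inr a.2) : MvPolynomial (Fin N ⊕ Fin N) ℤ))
    (fun a _ => (isWeightedHomogeneous_X ℤ (biweight N) (Sum.inl a.1)).mul
      (isWeightedHomogeneous_X ℤ (biweight N) (Sum.inr a.2))) i
  simpa using this

theorem isWeightedHomogeneous_biElemSymm (N i : ℕ) (k : Fin i ⊕ Fin i) :
    IsWeightedHomogeneous (biweight N) (biElemSymm N i k)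
      (Sum.elim (fun k : Fin i => ((k + 1 : ℕ), 0)) (fun k : Fin i => (0, (k + 1 : ℕ))) k) := by
  cases k with
  | inl k =>
    simpa [biElemSymm] using isWeightedHomogeneous_elemSymm (w := biweight N) (c := (1, 0)) (s := Finset.univ)
      (x := fun m => (X (Sum.inl m) : MvPolynomial (Fin N ⊕ Fin N) ℤ))
      (fun a _ => isWeightedHomogeneous_X ℤ (biweight N) (Sum.inl a)) (k + 1)
  | inr k =>
    simpa [biElemSymm] using isWeightedHomogeneous_elemSymm (w := biweight N) (c := (0, 1)) (s := Finset.univ)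
      (x := fun m => (X (Sum.inr m) : MvPolynomial (Fin N ⊕ Fin N) ℤ))
      (fun a _ => isWeightedHomogeneous_X ℤ (biweight N) (Sum.inr a)) (k + 1)

theorem weight_biweight {N : ℕ} (d : Fin N ⊕ Fin N →₀ ℕ) :
    Finsupp.weight (biweight N) d = (∑ m, d (Sum.inl m), ∑ m, d (Sum.inr m)) := by
  rw [Finsupp.weight_apply, Finsupp.sum_fintype _ _ (by simp), Fintype.sum_sum_type]
  ext <;> simp [biweight, Prod.fst_sum, Prod.snd_sum]

theorem inl_notMem_range_sumMap {σ τ : Type*} {f g : σ → τ} {m : τ} (hm : m ∉ Set.range f) :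
    (Sum.inl m : τ ⊕ τ) ∉ Set.range (Sum.map f g) := by
  rintro ⟨k | k, hk⟩
  · exact hm ⟨k, Sum.inl.inj hk⟩
  · cases hk

theorem inr_notMem_range_sumMap {σ τ : Type*} {f g : σ → τ} {m : τ} (hm : m ∉ Set.range g) :
    (Sum.inr m : τ ⊕ τ) ∉ Set.range (Sum.map f g) := by
  rintro ⟨k | k, hk⟩
  · cases hk
  · exact hm ⟨k, Sum.inr.inj hk⟩

theorem killCompl_biElemSymm {i N n : ℕ} {f g : Fin n → Fin N} (hf : Function.Injective f)
    (hg : Function.Injective g) (k : Fin i ⊕ Fin i) :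
    killCompl (hf.sumMap hg) (biElemSymm N i k) = biElemSymm n i k := by
  rcases k with k | k
  · simp only [biElemSymm, Sum.elim_inl, killCompl_elemSymm]
    refine elemSymm_eq_of_injOn f hf.injOn (fun _ _ => Finset.mem_univ _) (fun a _ => ?_)
      (fun b _ hb => ?_) _
    · rw [← killCompl_X_apply (hf.sumMap hg) (Sum.inl a), Sum.map_inl]
    · exact killCompl_X_of_notMem _ (inl_notMem_range_sumMap (by simpa using hb))
  · simp only [biElemSymm, Sum.elim_inr, killCompl_elemSymm]
    refine elemSymm_eq_of_injOn g hg.injOn (fun _ _ => Finset.mem_univ _) (fun a _ => ?_)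
      (fun b _ hb => ?_) _
    · rw [← killCompl_X_apply (hf.sumMap hg) (Sum.inr a), Sum.map_inr]
    · exact killCompl_X_of_notMem _ (inr_notMem_range_sumMap (by simpa using hb))

theorem killCompl_elemSymm_mul {N n : ℕ} {f g : Fin n → Fin N} (hf : Function.Injective f)
    (hg : Function.Injective g) (i : ℕ) :
    killCompl (hf.sumMap hg) (elemSymm (Finset.univ : Finset (Fin N × Fin N))
      (fun a => (X (Sum.inl a.1) * X (Sum.inr a.2) : MvPolynomial (Fin N ⊕ Fin N) ℤ)) i) =
      elemSymm (Finset.univ : Finset (Fin n × Fin n))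
        (fun a => (X (Sum.inl a.1) * X (Sum.inr a.2) : MvPolynomial (Fin n ⊕ Fin n) ℤ)) i := by
  rw [killCompl_elemSymm]
  refine elemSymm_eq_of_injOn (Prod.map f g) (hf.prodMap hg).injOn (by simp [Set.MapsTo])
    (fun a _ => ?_) (fun b _ hb => ?_) i
  · have h1 := killCompl_X_apply (hf.sumMap hg) (Sum.inl a.1)
    have h2 := killCompl_X_apply (hf.sumMap hg) (Sum.inr a.2)
    rw [Sum.map_inl] at h1
    rw [Sum.map_inr] at h2
    rw [map_mul, Prod.map_fst, Prod.map_snd, h1, h2]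
  · rw [map_mul]
    by_cases hb1 : b.1 ∈ Set.range f
    · by_cases hb2 : b.2 ∈ Set.range g
      · obtain ⟨k, hk⟩ := hb1
        obtain ⟨l, hl⟩ := hb2
        exact absurd ⟨(k, l), by simp, Prod.ext hk hl⟩ hb
      · rw [killCompl_X_of_notMem _ (inr_notMem_range_sumMap hb2), mul_zero]
    · rw [killCompl_X_of_notMem _ (inl_notMem_range_sumMap hb1), zero_mul]

/-- As for `aeval_compPoly`, but with bidegree `(i, i)`: a monomial of the difference involves at
most `i` variables of each group, so the two groups are restricted separately. -/
theorem aeval_mulPoly {i N : ℕ} (hN : i ≤ N) :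
    aeval (biElemSymm N i) (mulPoly i) =
      elemSymm (Finset.univ : Finset (Fin N × Fin N))
        (fun a => (X (Sum.inl a.1) * X (Sum.inr a.2) : MvPolynomial (Fin N ⊕ Fin N) ℤ)) i := by
  classical
  have hhom : IsWeightedHomogeneous
      (Sum.elim (fun k : Fin i => ((k + 1 : ℕ), 0)) (fun k : Fin i => (0, (k + 1 : ℕ))))
      (mulPoly i) (i, i) := by
    refine isWeightedHomogeneous_of_aeval (isWeightedHomogeneous_biElemSymm i i) ?_ ?_
    · rw [← substEsymm_eq_aeval]
      exact substEsymm_injective i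
    · rw [aeval_mulPoly_self]
      exact isWeightedHomogeneous_elemSymm_mul i i
  rw [← sub_eq_zero]
  have hD := (isWeightedHomogeneous_aeval (isWeightedHomogeneous_biElemSymm N i) hhom).sub
      (isWeightedHomogeneous_elemSymm_mul i N)
  refine eq_zero_of_killCompl (σ := Fin i ⊕ Fin i) fun d hd => ?_
  have hcard : ∀ e : Fin N → ℕ, ∑ m, e m = i → (Finset.univ.filter fun m => e m ≠ 0).card ≤ i := by
    intro e he
    rw [← he, Finset.card_filter]
    refine Finset.sum_le_sum fun k _ => ?_
    split_ifs <;> omega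
  have hw : Finsupp.weight (biweight N) d = (i, i) := hD (mem_support_iff.1 hd)
  rw [weight_biweight, Prod.mk.injEq] at hw
  obtain ⟨f, hf, hdf⟩ := exists_injective_subset_range hN (hcard _ hw.1)
  obtain ⟨g, hg, hdg⟩ := exists_injective_subset_range hN (hcard _ hw.2)
  refine ⟨Sum.map f g, hf.sumMap hg, ?_, ?_⟩
  · rintro (m | m) hm
    · obtain ⟨k, rfl⟩ := hdf (a := m) (by simpa using hm)
      exact ⟨Sum.inl k, rfl⟩
    · obtain ⟨k, rfl⟩ := hdg (a := m) (by simpa using hm)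
      exact ⟨Sum.inr k, rfl⟩
  rw [map_sub, sub_eq_zero, killCompl_aeval, killCompl_elemSymm_mul hf hg, ← aeval_mulPoly_self]
  simp only [killCompl_biElemSymm hf hg]

end Stability

/-! ### Newton polynomials of the universal sequences -/

section Universal

variable {A B : Type*} [CommRing A] [CommRing B]

/-- The sequence `P_i(a_1, …, a_i; b_1, …, b_i)`. -/
noncomputable def mulSeq (a b : ℕ → A) (i : ℕ) : A :=
  aeval (Sum.elim (fun k : Fin i => a (k + 1)) (fun k : Fin i => b (k + 1))) (mulPoly i)

/-- The value `P_{i,j}(a_1, …, a_{ij})`. -/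
noncomputable def compSeq (a : ℕ → A) (i j : ℕ) : A :=
  aeval (fun k : Fin (i * j) => a (k + 1)) (compPoly i j)

/-- `mulSeq` uses the canonical `ℤ`-algebra structure, whereas polynomial rings carry their own;
uniqueness of the structure reconciles the two. -/
theorem mulSeq_eq [inst : Algebra ℤ A] (a b : ℕ → A) (i : ℕ) :
    mulSeq a b i =
      aeval (Sum.elim (fun k : Fin i => a (k + 1)) (fun k : Fin i => b (k + 1))) (mulPoly i) := by
  obtain rfl := Subsingleton.elim (Ring.toIntAlgebra A) inst
  rfl

theorem compSeq_eq [inst : Algebra ℤ A] (a : ℕ → A) (i j : ℕ) :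
    compSeq a i j = aeval (fun k : Fin (i * j) => a (k + 1)) (compPoly i j) := by
  obtain rfl := Subsingleton.elim (Ring.toIntAlgebra A) inst
  rfl

theorem map_mulSeq (φ : A →+* B) (a b : ℕ → A) (i : ℕ) :
    φ (mulSeq a b i) = mulSeq (fun k => φ (a k)) (fun k => φ (b k)) i := by
  rw [mulSeq, mulSeq, ringHom_aeval]
  congr 2
  funext k
  cases k <;> rfl

theorem map_compSeq (φ : A →+* B) (a : ℕ → A) (i j : ℕ) :
    φ (compSeq a i j) = compSeq (fun k => φ (a k)) i j := by
  rw [compSeq, compSeq, ringHom_aeval]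

theorem mulSeq_congr {a a' b b' : ℕ → A} {i : ℕ} (ha : ∀ k, 1 ≤ k → k ≤ i → a k = a' k)
    (hb : ∀ k, 1 ≤ k → k ≤ i → b k = b' k) : mulSeq a b i = mulSeq a' b' i := by
  rw [mulSeq, mulSeq]
  congr 2
  funext k
  rcases k with k | k
  · exact ha _ (by omega) (by omega)
  · exact hb _ (by omega) (by omega)

theorem compSeq_congr {a a' : ℕ → A} {i j : ℕ} (ha : ∀ k, 1 ≤ k → k ≤ i * j → a k = a' k) :
    compSeq a i j = compSeq a' i j := by
  rw [compSeq, compSeq]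
  congr 2
  funext k
  exact ha _ (by omega) (by omega)

/-- The sequence whose term of index `k + 1` is `x_k` for `k < n` and `0` otherwise. -/
def extendSeq {n : ℕ} (x : Fin n → A) (k : ℕ) : A :=
  -- By truncated subtraction the term at `0` repeats the term at `1`; Newton and universal
  -- polynomials read only indices from `1` on.
  if h : k - 1 < n then x ⟨k - 1, h⟩ else 0

theorem extendSeq_of_le {n : ℕ} (x : Fin n → A) (a : ℕ → A) (h : ∀ k : Fin n, x k = a (k + 1))
    {k : ℕ} (h1 : 1 ≤ k) (hk : k ≤ n) : extendSeq x k = a k := by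
  have hk' : k - 1 < n := by omega
  rw [extendSeq, dif_pos hk', h]
  exact congrArg a (Nat.sub_add_cancel h1)

theorem map_extendSeq (φ : A →+* B) {n : ℕ} (x : Fin n → A) (k : ℕ) :
    φ (extendSeq x k) = extendSeq (fun i => φ (x i)) k := by
  unfold extendSeq
  split_ifs <;> simp

/-- The sequence of the `n` variables of the first group. -/
noncomputable def varL (n : ℕ) : ℕ → MvPolynomial (Fin n ⊕ Fin n) ℤ :=
  extendSeq fun k => X (Sum.inl k)

/-- The sequence of the `n` variables of the second group. -/
noncomputable def varR (n : ℕ) : ℕ → MvPolynomial (Fin n ⊕ Fin n) ℤ :=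
  extendSeq fun k => X (Sum.inr k)

/-- The sequence of the `n` variables of a polynomial ring. -/
noncomputable def varSeq (n : ℕ) : ℕ → MvPolynomial (Fin n) ℤ := extendSeq X

/-- Used for two specialisations of the generic identity: to elementary symmetric functions, where
it is proved, and to arbitrary sequences, where it is applied. -/
theorem map_newton_mulSeq_var {n : ℕ} (φ : MvPolynomial (Fin n ⊕ Fin n) ℤ →+* A) {a b : ℕ → A}
    (ha : ∀ k : Fin n, φ (X (Sum.inl k)) = a (k + 1))
    (hb : ∀ k : Fin n, φ (X (Sum.inr k)) = b (k + 1)) :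
    φ (newton (mulSeq (varL n) (varR n)) n) = newton (mulSeq a b) n ∧
      φ (newton (varL n) n * newton (varR n) n) = newton a n * newton b n := by
  have h1 : ∀ k, 1 ≤ k → k ≤ n → φ (varL n k) = a k := fun k hk hk' => by
    rw [varL, map_extendSeq, extendSeq_of_le _ _ ha hk hk']
  have h2 : ∀ k, 1 ≤ k → k ≤ n → φ (varR n k) = b k := fun k hk hk' => by
    rw [varR, map_extendSeq, extendSeq_of_le _ _ hb hk hk']
  constructor
  · rw [map_newton]
    refine newton_congr fun k hk hk' => ?_
    rw [map_mulSeq]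
    exact mulSeq_congr (fun l hl hl' => h1 l hl (by omega)) fun l hl hl' => h2 l hl (by omega)
  · rw [map_mul, map_newton, map_newton, newton_congr h1, newton_congr h2]

/-- On elementary symmetric functions this is `∑ (ξ_k η_l)^n = (∑ ξ_k^n) (∑ η_l^n)`. -/
theorem newton_mulSeq_var {n : ℕ} (hn : 1 ≤ n) :
    newton (mulSeq (varL n) (varR n)) n = newton (varL n) n * newton (varR n) n := by
  let U := MvPolynomial (Fin n ⊕ Fin n) ℤ
  let ev : ℕ → U := elemSymm Finset.univ fun m : Fin n => X (Sum.inl m)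
  let eu : ℕ → U := elemSymm Finset.univ fun m : Fin n => X (Sum.inr m)
  apply substEsymm_injective n
  have h := map_newton_mulSeq_var (substEsymm n : U →ₐ[ℤ] U).toRingHom (a := ev) (b := eu)
    (fun k => (congrArg (fun ψ => ψ (X (Sum.inl k))) (substEsymm_eq_aeval n)).trans
      (aeval_X _ _))
    (fun k => (congrArg (fun ψ => ψ (X (Sum.inr k))) (substEsymm_eq_aeval n)).trans
      (aeval_X _ _))
  refine h.1.trans (Eq.trans ?_ h.2.symm)
  have hmul : ∀ k, 1 ≤ k → k ≤ n → mulSeq ev eu k =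
      elemSymm (Finset.univ : Finset (Fin n × Fin n))
        (fun a => (X (Sum.inl a.1) * X (Sum.inr a.2) : U)) k :=
    fun k _ hk => (mulSeq_eq ev eu k).trans (aeval_mulPoly hk)
  rw [newton_congr hmul, newton_elemSymm _ _ hn, newton_elemSymm _ _ hn, newton_elemSymm _ _ hn,
    Finset.sum_mul_sum, Fintype.sum_prod_type]
  simp only [mul_pow]

theorem newton_mulSeq (a b : ℕ → A) {n : ℕ} (hn : 1 ≤ n) :
    newton (mulSeq a b) n = newton a n * newton b n := by
  have h := map_newton_mulSeq_var (aeval (Sum.elim (fun k : Fin n => a (k + 1))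
    (fun k : Fin n => b (k + 1))) : MvPolynomial (Fin n ⊕ Fin n) ℤ →ₐ[ℤ] A).toRingHom
    (a := a) (b := b) (fun k => by simp) (fun k => by simp)
  rw [← h.1, ← h.2, newton_mulSeq_var hn]

theorem map_newton_compSeq_var {m n : ℕ} (φ : MvPolynomial (Fin (m * n)) ℤ →+* A) {a : ℕ → A}
    (ha : ∀ k : Fin (m * n), φ (X k) = a (k + 1)) :
    φ (newton (fun j => newton (fun i => compSeq (varSeq (m * n)) i j) m) n) =
        newton (fun j => newton (fun i => compSeq a i j) m) n ∧
      φ (newton (varSeq (m * n)) (m * n)) = newton a (m * n) := by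
  have h1 : ∀ k, 1 ≤ k → k ≤ m * n → φ (varSeq (m * n) k) = a k := fun k hk hk' => by
    rw [varSeq, map_extendSeq, extendSeq_of_le _ _ ha hk hk']
  constructor
  · rw [map_newton]
    refine newton_congr fun j hj hj' => ?_
    rw [map_newton]
    refine newton_congr fun i hi hi' => ?_
    rw [map_compSeq]
    exact compSeq_congr fun l hl hl' => h1 l hl (hl'.trans (Nat.mul_le_mul hi' hj'))
  · rw [map_newton, newton_congr h1]

/-- On elementary symmetric functions, the inner Newton value is the `m`-th power sum of the
products of `j` distinct variables, that is, the `j`-th elementary symmetric function of the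
`ξ_l^m`. The outer one is then `∑ (ξ_l^m)^n`. -/
theorem newton_compSeq_var {m n : ℕ} (hm : 1 ≤ m) (hn : 1 ≤ n) :
    newton (fun j => newton (fun i => compSeq (varSeq (m * n)) i j) m) n =
      newton (varSeq (m * n)) (m * n) := by
  let U := MvPolynomial (Fin (m * n)) ℤ
  let e : ℕ → U := elemSymm Finset.univ (X : Fin (m * n) → U)
  apply aeval_esymm_injective (m * n)
  have h := map_newton_compSeq_var (aeval (fun k : Fin (m * n) => elemSymm Finset.univ X (k + 1)) :
    U →ₐ[ℤ] U).toRingHom (a := e) (fun k => aeval_X _ _)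
  refine h.1.trans (Eq.trans ?_ h.2.symm)
  have hcomp : ∀ j, 1 ≤ j → j ≤ n → newton (fun i => compSeq e i j) m =
      elemSymm Finset.univ (fun l : Fin (m * n) => (X l ^ m : U)) j := by
    intro j _ hj
    -- All `P_{i,j}` with `i ≤ m`, `j ≤ n` are evaluated in the same `mn` variables, which is why
    -- stability is needed.
    have hi : ∀ i, 1 ≤ i → i ≤ m → compSeq e i j =
        elemSymm (Finset.powersetCard j (Finset.univ : Finset (Fin (m * n))))
          (fun L => ∏ l ∈ L, (X l : U)) i :=
      fun i _ hi => (compSeq_eq e i j).trans (aeval_compPoly (Nat.mul_le_mul hi hj))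
    rw [newton_congr hi, newton_elemSymm _ _ hm, elemSymm_eq_sum]
    simp only [Finset.prod_pow]
  rw [newton_congr hcomp, newton_elemSymm _ _ hn, newton_elemSymm _ _ (Nat.mul_pos hm hn)]
  simp only [pow_mul]

theorem newton_compSeq (a : ℕ → A) {m n : ℕ} (hm : 1 ≤ m) (hn : 1 ≤ n) :
    newton (fun j => newton (fun i => compSeq a i j) m) n = newton a (m * n) := by
  have h := map_newton_compSeq_var (aeval (fun k : Fin (m * n) => a (k + 1)) :
    MvPolynomial (Fin (m * n)) ℤ →ₐ[ℤ] A).toRingHom (a := a) (fun k => by simp)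
  rw [← h.1, ← h.2, newton_compSeq_var hm hn]

end Universal

/-! ### Adams operations -/

section Adams

variable (R : Type*) [CommRing R] [LambdaRing R]

theorem adams_one_apply (r : R) : adams R 1 r = r := by
  rw [adams_apply]
  simp [newton, LambdaRing.lam_one]

theorem adams_map_one (n : ℕ+) : adams R n (1 : R) = 1 := by
  rw [adams_apply]
  -- The `λ`-operations on `1` are the elementary symmetric functions of the single variable `1`.
  have h : ∀ k, 1 ≤ k → k ≤ (n : ℕ) → LambdaRing.lam k (1 : R) =
      elemSymm (Finset.univ : Finset (Fin 1)) (fun _ => 1) k := by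
    intro k hk _
    rw [elemSymm]
    rcases hk.eq_or_lt with rfl | hk
    · simp [LambdaRing.lam_one, Polynomial.coeff_one]
    · simp [LambdaRing.lam_of_one k hk, Polynomial.coeff_one, Polynomial.coeff_X, hk.ne,
        (zero_lt_one.trans hk).ne']
  rw [newton_congr h, newton_elemSymm _ _ n.pos]
  simp

theorem adams_map_mul (n : ℕ+) (r s : R) : adams R n (r * s) = adams R n r * adams R n s := by
  rw [adams_apply, adams_apply, adams_apply, ← newton_mulSeq _ _ n.pos]
  exact newton_congr fun k _ _ => LambdaRing.lam_mul k r s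

/-- The Adams operation as a ring homomorphism. -/
def adamsRingHom (n : ℕ+) : R →+* R where
  toFun := adams R n
  map_one' := adams_map_one R n
  map_mul' := adams_map_mul R n
  map_zero' := map_zero _
  map_add' := map_add _

theorem adams_adams_apply (m n : ℕ+) (r : R) : adams R m (adams R n r) = adams R (m * n) r := by
  -- Being a ring homomorphism, `ψ^m` passes through the Newton polynomial that defines `ψ^n`,
  -- leaving the values `ψ^m(λ^j(r))`.
  have h := map_newton (adamsRingHom R m) (fun i => LambdaRing.lam i r) n
  refine h.trans ?_
  rw [adams_apply, PNat.mul_coe, ← newton_compSeq _ m.pos n.pos]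
  refine newton_congr fun j _ _ => ?_
  exact newton_congr fun i _ _ => LambdaRing.lam_lam i j r

/-- The Adams operations as a monoid homomorphism. -/
def adamsHom : ℕ+ →* Module.End ℤ R where
  toFun := adams R
  map_one' := LinearMap.ext (adams_one_apply R)
  map_mul' m n := LinearMap.ext fun r => (adams_adams_apply R m n r).symm

end Adams

/-! ### Monoid homomorphisms on the positive integers -/

section PNatHom

variable {M : Type*} [Monoid M]

theorem pnat_monoidHom_ext {f g : ℕ+ →* M} (h : ∀ p : Nat.Primes, f p = g p) : f = g := by
  ext n
  rw [← PNat.prod_factorMultiset n]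
  generalize n.factorMultiset = v
  induction v using Multiset.induction_on with
  | empty => exact (map_one f).trans (map_one g).symm
  | cons p v ih =>
    have hp : PrimeMultiset.prod (p ::ₘ v : Multiset Nat.Primes) = p * PrimeMultiset.prod v :=
      (PrimeMultiset.prod_add (PrimeMultiset.ofPrime p) v).trans
        (by rw [PrimeMultiset.prod_ofPrime])
    rw [hp, map_mul, map_mul, h p, ih]

-- Commuting elements generate a commutative submonoid, in which the product over the prime
-- factorisation is well defined and multiplicative.
open scoped IsMulCommutative in
theorem exists_pnat_monoidHom (g : Nat.Primes → M) (hg : ∀ p q, g p * g q = g q * g p) :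
    ∃ G : ℕ+ →* M, ∀ p : Nat.Primes, G p = g p := by
  have := Submonoid.isMulCommutative_closure M (s := Set.range g) (by
    rintro _ ⟨p, rfl⟩ _ ⟨q, rfl⟩
    exact hg p q)
  let g' : Nat.Primes → Submonoid.closure (Set.range g) :=
    fun p => ⟨g p, Submonoid.subset_closure ⟨p, rfl⟩⟩
  let F : ℕ+ →* Submonoid.closure (Set.range g) :=
    { toFun := fun n => (Multiset.map g' n.factorMultiset).prod
      map_one' := by rw [PNat.factorMultiset_one]; exact Multiset.prod_zero
      map_mul' := fun m n => by
        rw [PNat.factorMultiset_mul]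
        exact (congrArg Multiset.prod (Multiset.map_add g' _ _)).trans (Multiset.prod_add _ _) }
  refine ⟨(Submonoid.closure (Set.range g)).subtype.comp F, fun p => ?_⟩
  have : F p = g' p := by
    change (Multiset.map g' (PNat.factorMultiset p)).prod = g' p
    rw [PNat.factorMultiset_ofPrime]
    exact Multiset.prod_singleton _
  rw [MonoidHom.comp_apply, this]
  rfl

end PNatHom

/-! ### Derivations as monoid homomorphisms -/

section Derivations

variable (R : Type*) [CommRing R] [LambdaRing R]

/-- The element `(ψ^n, x)` of the square-zero extension of `End(R)`. -/
def adamsPair (n : ℕ+) (x : Module.End ℤ R) : TrivSqZeroExt (Module.End ℤ R) (Module.End ℤ R) :=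
  (adamsHom R n, x)

/-- A `λ`-derivation `f` as the monoid homomorphism `n ↦ (ψ^n, f(n))` to the square-zero extension
of `End(R)`. -/
def derHom (f : Der R) : ℕ+ →* TrivSqZeroExt (Module.End ℤ R) (Module.End ℤ R) where
  toFun n := adamsPair R n (f.1.1 n)
  map_one' := by
    have h := (mem_Der_iff R f.1).1 f.2 1 1
    have h1 : adams R 1 = 1 := map_one (adamsHom R)
    rw [h1, mul_one, one_mul, mul_one] at h
    -- The cocycle identity at `(1, 1)` reads `f(1) = f(1) + f(1)`, so `f(1) = 0`.
    exact TrivSqZeroExt.ext (map_one _) (left_eq_add.1 h)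
  map_mul' m n := TrivSqZeroExt.ext (map_mul _ m n) ((mem_Der_iff R f.1).1 f.2 m n)

theorem restrictPrimes_injective : Function.Injective (restrictPrimes R) := by
  intro f g h
  have hfg : derHom R f = derHom R g := pnat_monoidHom_ext fun p =>
    congrArg (adamsPair R p) (congrFun (congrArg Subtype.val h) p)
  apply Subtype.ext
  apply Subtype.ext
  funext n
  exact congrArg TrivSqZeroExt.snd (DFunLike.congr_fun hfg n)

theorem restrictPrimes_surjective : Function.Surjective (restrictPrimes R) := by
  rintro ⟨f, hf, hcomm⟩
  obtain ⟨G, hG⟩ := exists_pnat_monoidHom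
    (fun p : Nat.Primes => adamsPair R p (f p))
    -- First components commute since `ψ^p ψ^q = ψ^{pq}`; for the second components, commutation is
    -- the `DerBar` condition.
    (fun p q => TrivSqZeroExt.ext
      (by
        change adamsHom R p * adamsHom R q = adamsHom R q * adamsHom R p
        rw [← map_mul, mul_comm, map_mul]) (hcomm p q))
  -- `G` is prescribed only at primes; its first component is a homomorphism agreeing there with
  -- `ψ`, hence everywhere.
  have hfst : ∀ n, (G n).fst = adams R n := by
    have h : ((TrivSqZeroExt.fstHom ℤ (Module.End ℤ R) (Module.End ℤ R)).toRingHom.toMonoidHom).comp G =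
        adamsHom R := pnat_monoidHom_ext fun p => by
      change (G p).fst = _
      rw [hG]
      rfl
    exact fun n => DFunLike.congr_fun h n
  have hsnd : ∀ p : Nat.Primes, (G p).snd = f p := fun p => congrArg TrivSqZeroExt.snd (hG p)
  refine ⟨⟨⟨fun n => (G n).snd, fun p hp r => ?_⟩, (mem_Der_iff R _).2 fun m n => ?_⟩, ?_⟩
  · have h : (G p).snd = f ⟨p, hp⟩ := hsnd ⟨p, hp⟩
    change _ ∣ (G p).snd r
    rw [h]
    exact hf ⟨p, hp⟩ r
  · change (G (m * n)).snd = adams R m * (G n).snd + (G m).snd * adams R n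
    rw [map_mul, ← hfst, ← hfst]
    rfl
  · exact Subtype.ext (funext hsnd)

theorem d0_mem_Der (g : F0 R) : d0 R g ∈ Der R := by
  refine (mem_Der_iff R _).2 fun m n => ?_
  change adams R (m * n) * (g : Module.End ℤ R) - (g : Module.End ℤ R) * adams R (m * n) =
    adams R m * (adams R n * (g : Module.End ℤ R) - (g : Module.End ℤ R) * adams R n) +
      (adams R m * (g : Module.End ℤ R) - (g : Module.End ℤ R) * adams R m) * adams R n
  rw [show adams R (m * n) = adams R m * adams R n from map_mul (adamsHom R) m n]
  noncomm_ring

/-- The same `g` serves on both sides: the family `[ψ^p, g]` is the restriction of the coboundary of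
`g`, which is a cocycle by `d0_mem_Der`. -/
theorem map_restrictPrimes_Inn :
    ((Inn R).addSubgroupOf (Der R)).map (restrictPrimes R) =
      (InnBar R).addSubgroupOf (DerBar R) := by
  ext f
  rw [AddSubgroup.mem_map, AddSubgroup.mem_addSubgroupOf]
  constructor
  · rintro ⟨f, hf, rfl⟩
    obtain ⟨g, hg⟩ := AddSubgroup.mem_addSubgroupOf.1 hf
    refine ⟨g, ?_⟩
    change _ = fun p : Nat.Primes => f.1.1 p
    rw [← hg]
    rfl
  · rintro ⟨g, hg⟩
    exact ⟨⟨d0 R g, d0_mem_Der R g⟩, AddSubgroup.mem_addSubgroupOf.2 ⟨g, rfl⟩, Subtype.ext hg⟩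

end Derivations

end LambdaCohomology

theorem theorem2p2 (R : Type*) [CommRing R] [LambdaCohomology.LambdaRing R] :
    ∃ e : LambdaCohomology.H1 R ≃+ LambdaCohomology.H1Bar R,
      ∀ f : LambdaCohomology.Der R,
        e (QuotientAddGroup.mk f) =
          QuotientAddGroup.mk (LambdaCohomology.restrictPrimes R f) :=
  ⟨QuotientAddGroup.congr _ _ (AddEquiv.ofBijective (LambdaCohomology.restrictPrimes R)
    ⟨LambdaCohomology.restrictPrimes_injective R, LambdaCohomology.restrictPrimes_surjective R⟩)
    (LambdaCohomology.map_restrictPrimes_Inn R), fun _ => rfl⟩
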